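/- **Definitions.** Composition is written in diagrammatic order: $f;g$ means first $f$, then $g$. Sets and the categories in $\mathrm{Cat}$ are small with respect to a universe large enough to contain the objects and morphisms of $\mathcal D$ and the morphisms of $\mathcal T$. Let $\mathbf t:\mathcal D\to\mathcal T$ be a functor between monoidal categories. An object $P\in\mathcal D$ *refines* $A\in\mathcal T$, written $P\sqsubset A$, if $\mathbf t(P)=A$; a *derivation* of $P\Rightarrow_c Q$ is a morphism $\alpha:P\to Q$ with $\mathbf t(\alpha)=c$. A *left residual* of $R$ by $P$ is an object $P\backslash R$ with a morphism $\mathrm{plug}:P\otimes(P\backslash R)\to R$ such that every $f:P\otimes Y\to R$ equals $(P\otimes g);\mathrm{plug}$ for a unique $g:Y\to P\backslash R$; *right residuals* $R/Q$, with $\mathrm{plug}:(R/Q)\otimes Q\to R$, are defined symmetrically. $\mathbf t$ is a *logical refinement system* if it is strict monoidal and preserves (together with the plug maps) all left and right residuals that exist in $\mathcal D$. Let $\mathbf u:\mathrm{Psh}\to\mathrm{Cat}$ be the forgetful functor, where an object of $\mathrm{Psh}$ is a category $\mathcal A$ with a presheaf $\phi:\mathcal A^{op}\to\mathrm{Set}$,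 and a morphism $(\mathcal A,\phi)\to(\mathcal B,\psi)$ is a functor $F:\mathcal A\to\mathcal B$ with a natural transformation $\phi\Rightarrow\psi\circ F^{op}$. For presheaves $\phi$ on $\mathcal A$, $\psi$ on $\mathcal B$, $\omega$ on $\mathcal C$ and a functor $F:\mathcal A\to\mathcal B$, put - $\phi\otimes\psi:(a,b)\mapsto\phi(a)\times\psi(b)$, a presheaf on $\mathcal A\times\mathcal B$; - $\phi\backslash\omega$ and $\omega/\phi$, both the presheaf $G\mapsto\mathrm{Nat}(\phi,\omega\circ G^{op})$ on the functor category $[\mathcal A,\mathcal C]$; - $F^*\psi:a\mapsto\psi(Fa)$, with its canonical morphism $F^*\psi\to\psi$ over $F$; - $F_*\phi:b\mapsto\int^{a}\mathcal B(b,Fa)\times\phi(a)$, with its canonical morphism $\phi\to F_*\phi$ over $F$. A *vertical isomorphism* between presheaves on the same category is an isomorphism in $\mathrm{Psh}$ lying over the identity functor. For $B\in\mathcal T$, let $B^+$ be the category whose objects are pairs $(P,c)$ with $P\in\mathcal D$ and $c:\mathbf t(P)\to B$, and whose morphisms $(P_1,c_1)\to(P_2,c_2)$ are the $\alpha:P_1\to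 P_2$ with $c_1=\mathbf t(\alpha);c_2$. For $c:B\to C$ let $c^+:B^+\to C^+$ be $(P,d)\mapsto(P,d;c)$. For $Q\sqsubset B$, let $Q^+$ be the presheaf on $B^+$ sending $(P,c)$ to the set of derivations of $P\Rightarrow_c Q$; a derivation $\alpha$ of $Q\Rightarrow_c R$ induces $\alpha^+:Q^+\to R^+$ over $c^+$ by postcomposition. For $\mathbf t$ strict monoidal, let $m_{A,B}:A^+\times B^+\to(A\otimes B)^+$ be $((P,c),(Q,d))\mapsto(P\otimes Q,c\otimes d)$, and for $P\sqsubset A$, $Q\sqsubset B$ let $m_{P,Q}:P^+\otimes Q^+\to(P\otimes Q)^+$ be the morphism over $m_{A,B}$ given by $(\alpha,\beta)\mapsto\alpha\otimes\beta$. When the residual $P\backslash R\sqsubset A\backslash C$ exists (with plug maps one over the other), let $\ell_{A,C}:(A\backslash C)^+\to[A^+,C^+]$ and, over it, $\ell_{P,R}:(P\backslash R)^+\to P^+\backslash R^+$ be the left curryings of $m_{A,A\backslash C};\mathrm{plug}^+$ and of $m_{P,P\backslash R};\mathrm{plug}^+$. When $R/Q\sqsubset C/B$ exists, let $r_{B,C}:(C/B)^+\to[B^+,C^+]$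 and $r_{Q,R}:(R/Q)^+\to R^+/Q^+$ be the right curryings of $m_{C/B,B};\mathrm{plug}^+$ and of $m_{R/Q,Q};\mathrm{plug}^+$. **Proposition (generalized Day embedding).** Let $\mathbf t:\mathcal D\to\mathcal T$ be a logical refinement system and let $P\sqsubset A$, $Q\sqsubset B$, $R\sqsubset C$. (a) $m_{P,Q}$ is opcartesian over $m_{A,B}$ relative to $\mathbf u$, and there is a vertical isomorphism $(m_{A,B})_*(P^+\otimes Q^+)\cong(P\otimes Q)^+$ compatible with $m_{P,Q}$ and the canonical morphism $P^+\otimes Q^+\to(m_{A,B})_*(P^+\otimes Q^+)$. (b) If a left residual $P\backslash R$ exists in $\mathcal D$, then $\ell_{P,R}$ is cartesian over $\ell_{A,C}$ relative to $\mathbf u$, and there is a vertical isomorphism $(P\backslash R)^+\cong\ell_{A,C}^{\,*}(P^+\backslash R^+)$ compatible with $\ell_{P,R}$ and the canonical morphism $\ell_{A,C}^{\,*}(P^+\backslash R^+)\to P^+\backslash R^+$. (c) If a right residual $R/Q$ exists in $\mathcal D$, then $r_{Q,R}$ is cartesian over $r_{B,C}$ relative to $\mathbf u$, and there is a vertical isomorphism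 $(R/Q)^+\cong r_{B,C}^{\,*}(R^+/Q^+)$ compatible with $r_{Q,R}$ and the canonical morphism $r_{B,C}^{\,*}(R^+/Q^+)\to R^+/Q^+$. Here (op)cartesian is meant in the strong sense, i.e. with the universal property for morphisms lying over arbitrary composites. -/

import Mathlib

open CategoryTheory MonoidalCategory Opposite

universe w v₁ v₂ u₁ u₂

namespace RefSys

/-! ### Residuals in a monoidal category -/

section Residuals

variable {C : Type u₁} [Category.{v₁} C] [MonoidalCategory C]

/-- `plug : P ⊗ X ⟶ R` exhibits `X` as the left residual `P \ R`: every `f : P ⊗ Y ⟶ R` is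
`P ◁ g ≫ plug` for a unique `g : Y ⟶ X`. -/
def IsLeftResidual {P R X : C} (plug : P ⊗ X ⟶ R) : Prop :=
  ∀ (Y : C) (f : P ⊗ Y ⟶ R), ∃! g : Y ⟶ X, P ◁ g ≫ plug = f

/-- `plug : X ⊗ Q ⟶ R` exhibits `X` as the right residual `R / Q`: every `f : Y ⊗ Q ⟶ R` is
`g ▷ Q ≫ plug` for a unique `g : Y ⟶ X`. -/
def IsRightResidual {Q R X : C} (plug : X ⊗ Q ⟶ R) : Prop :=
  ∀ (Y : C) (f : Y ⊗ Q ⟶ R), ∃! g : Y ⟶ X, g ▷ Q ≫ plug = f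

end Residuals

/-! ### Logical refinement systems -/

section Logical

variable {D : Type u₁} [Category.{v₁} D] {T : Type u₂} [Category.{v₂} T]
  [MonoidalCategory D] [MonoidalCategory T]

/-- A monoidal refinement system: the functor `t` is strict monoidal, i.e. it preserves the tensor
product, the unit and the structural isomorphisms on the nose. -/
structure IsMonoidalRefinement (t : D ⥤ T) : Prop where
  tensor_obj (P Q : D) : t.obj (P ⊗ Q) = t.obj P ⊗ t.obj Q
  unit_obj : t.obj (𝟙_ D) = 𝟙_ T
  tensor_map {P P' Q Q' : D} (f : P ⟶ P') (g : Q ⟶ Q') :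
    t.map (f ⊗ₘ g) = eqToHom (tensor_obj P Q) ≫ (t.map f ⊗ₘ t.map g) ≫
      eqToHom (tensor_obj P' Q').symm
  associator (P Q R : D) : t.IsHomLift (α_ (t.obj P) (t.obj Q) (t.obj R)).hom (α_ P Q R).hom
  leftUnitor (P : D) : t.IsHomLift (λ_ (t.obj P)).hom (λ_ P).hom
  rightUnitor (P : D) : t.IsHomLift (ρ_ (t.obj P)).hom (ρ_ P).hom

/-- A logical refinement system: a monoidal refinement system which preserves all the left and
right residuals that exist in its domain. -/
structure IsLogicalRefinement (t : D ⥤ T) : Prop extends IsMonoidalRefinement t where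
  leftResidual {P R X : D} (plug : P ⊗ X ⟶ R) : IsLeftResidual plug →
    IsLeftResidual (eqToHom (tensor_obj P X).symm ≫ t.map plug)
  rightResidual {Q R X : D} (plug : X ⊗ Q ⟶ R) : IsRightResidual plug →
    IsRightResidual (eqToHom (tensor_obj X Q).symm ≫ t.map plug)

variable {t : D ⥤ T}

theorem IsMonoidalRefinement.isHomLift_tensor (ht : IsMonoidalRefinement t)
    {P P' Q Q' : D} {B B' : T} (c : t.obj P ⟶ B) (d : t.obj Q ⟶ B') (f : P ⟶ P') (g : Q ⟶ Q')
    (hf : t.IsHomLift c f) (hg : t.IsHomLift d g) :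
    t.IsHomLift (eqToHom (ht.tensor_obj P Q) ≫ (c ⊗ₘ d)) (f ⊗ₘ g) := by
  have hB := IsHomLift.codomain_eq t c f
  have hB' := IsHomLift.codomain_eq t d g
  subst hB hB'
  obtain rfl := IsHomLift.eq_of_isHomLift t c f
  obtain rfl := IsHomLift.eq_of_isHomLift t d g
  refine IsHomLift.of_fac _ _ _ rfl (ht.tensor_obj P' Q') ?_
  simp [ht.tensor_map]

/-- The tensor product of refinements `P ⊏ A` and `Q ⊏ B`, a refinement of `A ⊗ B`. -/
def IsMonoidalRefinement.tensor (ht : IsMonoidalRefinement t) {A B : T}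
    (P : t.Fiber A) (Q : t.Fiber B) : t.Fiber (A ⊗ B) :=
  ⟨P.1 ⊗ Q.1, by rw [ht.tensor_obj, P.2, Q.2]⟩

end Logical

/-! ### The refinement system of presheaves -/

/-- A (small) category equipped with a presheaf. -/
structure Psh : Type (w + 1) where
  base : Cat.{w, w}
  psh : baseᵒᵖ ⥤ Type w

namespace Psh

/-- A morphism `(𝒜, φ) ⟶ (ℬ, ψ)`: a functor `F : 𝒜 ⥤ ℬ` with a natural transformation
`φ ⟶ F ⋙ ψ`. -/
structure Hom (X Y : Psh.{w}) : Type w where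
  base : X.base ⟶ Y.base
  psh : X.psh ⟶ base.toFunctor.op ⋙ Y.psh

instance : Category Psh.{w} where
  Hom := Hom
  id X := ⟨𝟙 _, 𝟙 X.psh⟩
  comp f g := ⟨f.base ≫ g.base, f.psh ≫ Functor.whiskerLeft f.base.toFunctor.op g.psh⟩

/-- The forgetful functor from presheaves to categories. -/
def forget : Psh.{w} ⥤ Cat.{w, w} where
  obj X := X.base
  map f := Hom.base f

/-- The external tensor product: `(a, b) ↦ φ a × ψ b` over the product category. -/
def tensor (X Y : Psh.{w}) : Psh.{w} where
  base := Cat.of (X.base × Y.base)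
  psh :=
    { obj p := X.psh.obj (op p.unop.1) × Y.psh.obj (op p.unop.2)
      map f := ↾fun x => (X.psh.map f.unop.1.op x.1, Y.psh.map f.unop.2.op x.2)
      map_id p := by
        ext x
        · exact X.psh.map_id_apply (op p.unop.1) x.1
        · exact Y.psh.map_id_apply (op p.unop.2) x.2
      map_comp f g := by
        ext x
        · exact X.psh.map_comp_apply f.unop.1.op g.unop.1.op x.1
        · exact Y.psh.map_comp_apply f.unop.2.op g.unop.2.op x.2 }

/-- The external residual: the presheaf `F ↦ ∀ a, φ a → ω (F a)` over the functor category, whose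
elements at `F` are the natural transformations `φ ⟶ F ⋙ ω`. Since the tensor product of categories
is the cartesian product, the same formula gives both the left residual of `Z` by `X` and the right
residual of `Z` by `X`. -/
def residual (X Z : Psh.{w}) : Psh.{w} where
  base := Cat.of (X.base ⥤ Z.base)
  psh :=
    { obj F := X.psh ⟶ F.unop.op ⋙ Z.psh
      map f := ↾fun x => x ≫ Functor.whiskerRight (NatTrans.op f.unop) Z.psh
      map_id F := by
        ext x a y
        exact Z.psh.map_id_apply (op (F.unop.obj a.unop)) (x.app a y)
      map_comp f g := by
        ext x a y
        exact Z.psh.map_comp_apply (f.unop.app a.unop).op (g.unop.app a.unop).op (x.app a y) }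

/-- Left currying of a functor. -/
def curryLBase {A B C : Cat.{w, w}} (F : Cat.of (A × B) ⟶ C) : B ⟶ Cat.of (A ⥤ C) :=
  (Functor.curry.obj (CategoryTheory.Prod.swap B A ⋙ F.toFunctor)).toCatHom

/-- Right currying of a functor. -/
def curryRBase {A B C : Cat.{w, w}} (F : Cat.of (A × B) ⟶ C) : A ⟶ Cat.of (B ⥤ C) :=
  (Functor.curry.obj F.toFunctor).toCatHom

theorem tensor_naturality {X Y Z : Psh.{w}} (f : tensor X Y ⟶ Z) {a a' : X.base} {b b' : Y.base}
    (u : a' ⟶ a) (v : b' ⟶ b) (x : X.psh.obj (op a)) (y : Y.psh.obj (op b)) :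
    (Hom.psh f).app (op (a', b')) (X.psh.map u.op x, Y.psh.map v.op y) =
      Z.psh.map (Quiver.Hom.op ((Hom.base f).toFunctor.map
        (X := ((a', b') : X.base × Y.base)) (Y := ((a, b) : X.base × Y.base)) (u, v)))
        ((Hom.psh f).app (op (a, b)) (x, y)) := by
  have h := (Hom.psh f).naturality
    (Quiver.Hom.op (X := ((a', b') : X.base × Y.base)) (Y := ((a, b) : X.base × Y.base)) (u, v))
  let p : X.psh.obj (op a) × Y.psh.obj (op b) := (x, y)
  exact ConcreteCategory.congr_hom h p

theorem tensor_naturality_left {X Y Z : Psh.{w}} (f : tensor X Y ⟶ Z) {a a' : X.base} {b : Y.base}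
    (u : a' ⟶ a) (x : X.psh.obj (op a)) (y : Y.psh.obj (op b)) :
    (Hom.psh f).app (op (a', b)) (X.psh.map u.op x, y) =
      Z.psh.map (Quiver.Hom.op ((Hom.base f).toFunctor.map
        (X := ((a', b) : X.base × Y.base)) (Y := ((a, b) : X.base × Y.base)) (u, 𝟙 b)))
        ((Hom.psh f).app (op (a, b)) (x, y)) :=
  Eq.trans (congrArg (fun z => (Hom.psh f).app (op (a', b)) (X.psh.map u.op x, z))
    (Y.psh.map_id_apply (op b) y).symm) (tensor_naturality f u (𝟙 b) x y)

theorem tensor_naturality_right {X Y Z : Psh.{w}} (f : tensor X Y ⟶ Z) {a : X.base} {b b' : Y.base}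
    (v : b' ⟶ b) (x : X.psh.obj (op a)) (y : Y.psh.obj (op b)) :
    (Hom.psh f).app (op (a, b')) (x, Y.psh.map v.op y) =
      Z.psh.map (Quiver.Hom.op ((Hom.base f).toFunctor.map
        (X := ((a, b') : X.base × Y.base)) (Y := ((a, b) : X.base × Y.base)) (𝟙 a, v)))
        ((Hom.psh f).app (op (a, b)) (x, y)) :=
  Eq.trans (congrArg (fun z => (Hom.psh f).app (op (a, b')) (z, Y.psh.map v.op y))
    (X.psh.map_id_apply (op a) x).symm) (tensor_naturality f (𝟙 a) v x y)

/-- Left currying: from `X ⊗ Y ⟶ Z` to `Y ⟶ X \ Z`. -/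
def curryL {X Y Z : Psh.{w}} (f : tensor X Y ⟶ Z) : Y ⟶ residual X Z where
  base := curryLBase (Hom.base f)
  psh :=
    { app b := ↾fun y =>
        { app a := ↾fun x => (Hom.psh f).app (op (a.unop, b.unop)) (x, y)
          naturality a a' u := by
            ext x
            exact tensor_naturality_left f u.unop x y }
      naturality b b' u := by
        ext y
        apply NatTrans.ext
        funext a
        ext x
        exact tensor_naturality_right f u.unop x y }

/-- Right currying: from `X ⊗ Y ⟶ Z` to `X ⟶ Z / Y`. -/
def curryR {X Y Z : Psh.{w}} (f : tensor X Y ⟶ Z) : X ⟶ residual Y Z where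
  base := curryRBase (Hom.base f)
  psh :=
    { app a := ↾fun x =>
        { app b := ↾fun y => (Hom.psh f).app (op (a.unop, b.unop)) (x, y)
          naturality b b' u := by
            ext y
            exact tensor_naturality_right f u.unop x y }
      naturality a a' u := by
        ext x
        apply NatTrans.ext
        funext b
        ext y
        exact tensor_naturality_left f u.unop x y }

/-- The pullback of a presheaf along a functor, by precomposition. -/
def pull {A : Cat.{w, w}} (Y : Psh.{w}) (F : A ⟶ Y.base) : Psh.{w} where
  base := A
  psh := F.toFunctor.op ⋙ Y.psh

/-- The structural morphism from the pullback. -/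
def pullProj {A : Cat.{w, w}} (Y : Psh.{w}) (F : A ⟶ Y.base) : pull Y F ⟶ Y where
  base := F
  psh := 𝟙 _

/-- The relation generating the coend `∃ a, ℬ(b, F a) × φ a`. -/
inductive PushRel {B : Cat.{w, w}} (X : Psh.{w}) (F : X.base ⟶ B) (b : B) :
    (Σ a : X.base, (b ⟶ F.toFunctor.obj a) × X.psh.obj (op a)) →
    (Σ a : X.base, (b ⟶ F.toFunctor.obj a) × X.psh.obj (op a)) → Prop
  | glue {a a' : X.base} (u : a ⟶ a') (f : b ⟶ F.toFunctor.obj a) (x : X.psh.obj (op a')) :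
    PushRel X F b ⟨a, f, X.psh.map u.op x⟩ ⟨a', f ≫ F.toFunctor.map u, x⟩

/-- The pushforward of a presheaf along a functor: the coend `b ↦ ∃ a, ℬ(b, F a) × φ a`. -/
def push {B : Cat.{w, w}} (X : Psh.{w}) (F : X.base ⟶ B) : Psh.{w} where
  base := B
  psh :=
    { obj b := Quot (PushRel X F b.unop)
      map g := ↾Quot.map (fun x => ⟨x.1, g.unop ≫ x.2.1, x.2.2⟩) (by
        rintro _ _ ⟨u, f, x⟩
        have := PushRel.glue (X := X) (F := F) u (g.unop ≫ f) x
        rwa [Category.assoc] at this)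
      map_id b := by
        ext x
        induction x using Quot.ind with | mk x => ?_
        exact congrArg (fun f => Quot.mk (PushRel X F b.unop) ⟨x.1, f, x.2.2⟩)
          (Category.id_comp x.2.1)
      map_comp {b b' b''} g h := by
        ext x
        induction x using Quot.ind with | mk x => ?_
        exact congrArg (fun f => Quot.mk (PushRel X F b''.unop) ⟨x.1, f, x.2.2⟩)
          (Category.assoc h.unop g.unop x.2.1) }

/-- The structural morphism to the pushforward. -/
def pushUnit {B : Cat.{w, w}} (X : Psh.{w}) (F : X.base ⟶ B) : X ⟶ push X F where
  base := F
  psh :=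
    { app a := ↾fun x => Quot.mk _ ⟨a.unop, 𝟙 _, x⟩
      naturality a a' u := by
        ext x
        refine (Quot.sound (PushRel.glue (X := X) (F := F) u.unop (𝟙 _) x)).trans ?_
        exact congrArg (fun f => Quot.mk (PushRel X F (F.toFunctor.obj a'.unop)) ⟨a.unop, f, x⟩)
          ((Category.id_comp _).trans (Category.comp_id _).symm) }

end Psh

/-! ### The positive representation -/

section Positive

variable {D : Type u₁} [Category.{v₁} D] {T : Type u₂} [Category.{v₂} T]

/-- Objects of the relative slice of `B`: a refinement `P` of some `A` with a term `c : A ⟶ B`. -/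
structure Slice (t : D ⥤ T) (B : T) : Type (max u₁ v₁ v₂) where
  ref : D
  term : t.obj ref ⟶ B

namespace Slice

/-- Morphisms `(P₁, c₁) ⟶ (P₂, c₂)`: derivations `α : P₁ ⟶ P₂` over some `e` with
`c₁ = e ≫ c₂`. -/
@[ext]
structure Hom {t : D ⥤ T} {B : T} (X Y : Slice t B) : Type (max u₁ v₁ v₂) where
  hom : X.ref ⟶ Y.ref
  w : X.term = t.map hom ≫ Y.term

instance (t : D ⥤ T) (B : T) : Category.{max u₁ v₁ v₂} (Slice t B) where
  Hom := Hom
  id X := ⟨𝟙 _, by simp⟩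
  comp f g := ⟨f.hom ≫ g.hom, by rw [f.w, g.w]; simp⟩
  id_comp f := Hom.ext (Category.id_comp _)
  comp_id f := Hom.ext (Category.comp_id _)
  assoc f g h := Hom.ext (Category.assoc _ _ _)

theorem eqToHom_hom {t : D ⥤ T} {B : T} {X Y : Slice t B} (h : X = Y) :
    Hom.hom (eqToHom h) = eqToHom (congrArg Slice.ref h) := by
  subst h; rfl

end Slice

/-- Postcomposition with `c`, as a functor between relative slices. -/
def sliceMap (t : D ⥤ T) {B C : T} (c : B ⟶ C) : Slice t B ⥤ Slice t C where
  obj X := ⟨X.ref, X.term ≫ c⟩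
  map f := ⟨f.hom, by rw [f.w, Category.assoc]⟩

/-- The relative slice functor `T ⥤ Cat`. -/
def posBase (t : D ⥤ T) : T ⥤ Cat.{max u₁ v₁ v₂, max u₁ v₁ v₂} where
  obj B := Cat.of (Slice t B)
  map c := (sliceMap t c).toCatHom
  map_id B := by
    apply Cat.Hom.ext
    refine CategoryTheory.Functor.ext
      (fun X => congrArg (Slice.mk X.ref) (Category.comp_id X.term)) (fun X Y f => ?_)
    apply Slice.Hom.ext
    refine Eq.trans ?_ (congrArg₂ (fun a b => a ≫ f.hom ≫ b)
      (Slice.eqToHom_hom _) (Slice.eqToHom_hom _)).symm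
    exact ((Category.id_comp _).trans (Category.comp_id f.hom)).symm
  map_comp {B₁ B₂ B₃} c d := by
    apply Cat.Hom.ext
    have h (X : Slice t B₁) :
        (sliceMap t (c ≫ d)).obj X = (sliceMap t c ⋙ sliceMap t d).obj X :=
      congrArg (Slice.mk X.ref) (Category.assoc X.term c d).symm
    refine CategoryTheory.Functor.ext (F := sliceMap t (c ≫ d))
      (G := sliceMap t c ⋙ sliceMap t d) h (fun X Y f => ?_)
    apply Slice.Hom.ext
    refine Eq.trans ?_ (congrArg₂ (fun a b => a ≫ f.hom ≫ b)
      (Slice.eqToHom_hom (h X)) (Slice.eqToHom_hom (h Y).symm)).symm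
    exact ((Category.id_comp _).trans (Category.comp_id f.hom)).symm

/-- Derivations of the judgment `P ⟹[c] Q`. -/
@[ext]
structure Deriv (t : D ⥤ T) {P : D} {B : T} (c : t.obj P ⟶ B) (Q : t.Fiber B) :
    Type (max u₁ v₁ v₂) where
  hom : P ⟶ Q.1
  lift : t.IsHomLift c hom

/-- The positive representation of a refinement `Q ⊏ B`: the presheaf on the relative slice of `B`
sending `(P, c)` to the set of derivations of `P ⟹[c] Q`. -/
def pos {t : D ⥤ T} {B : T} (Q : t.Fiber B) : Psh.{max u₁ v₁ v₂} where
  base := (posBase t).obj B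
  psh :=
    { obj X := Deriv t (Slice.term X.unop) Q
      map f := ↾fun α => ⟨Slice.Hom.hom f.unop ≫ α.hom, by
        have := α.lift
        rw [Slice.Hom.w f.unop]
        infer_instance⟩
      map_id X := by
        ext α
        exact Category.id_comp α.hom
      map_comp f g := by
        ext α
        exact Category.assoc (Slice.Hom.hom g.unop) (Slice.Hom.hom f.unop) α.hom }

/-- The action of the positive representation on derivations. -/
def posMap {t : D ⥤ T} {B C : T} {Q : t.Fiber B} {R : t.Fiber C} (c : B ⟶ C) (α : Q.1 ⟶ R.1)
    (h : t.IsHomLift c α) : pos Q ⟶ pos R where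
  base := (posBase t).map c
  psh :=
    { app X := ↾fun β => ⟨β.hom ≫ α, by
        have := β.lift
        exact inferInstanceAs (t.IsHomLift (Slice.term X.unop ≫ c) (β.hom ≫ α))⟩
      naturality X Y f := by
        ext β
        exact Deriv.ext (Category.assoc (Slice.Hom.hom f.unop) β.hom α) }

variable [MonoidalCategory D] [MonoidalCategory T] {t : D ⥤ T}

/-- The functor `m_{A,B}` sending `((P, c), (Q, d))` to `(P ⊗ Q, c ⊗ d)`. -/
def strBase (ht : IsMonoidalRefinement t) (A B : T) :
    Cat.of ((posBase t).obj A × (posBase t).obj B) ⟶ (posBase t).obj (A ⊗ B) :=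
  Functor.toCatHom
    { obj X := (⟨Slice.ref X.1 ⊗ Slice.ref X.2,
        eqToHom (ht.tensor_obj _ _) ≫ (Slice.term X.1 ⊗ₘ Slice.term X.2)⟩ : Slice t (A ⊗ B))
      map f := (⟨Slice.Hom.hom f.1 ⊗ₘ Slice.Hom.hom f.2, by
        rw [Slice.Hom.w f.1, Slice.Hom.w f.2, ht.tensor_map]
        simp⟩ : Slice.Hom _ _)
      map_id X := Slice.Hom.ext (id_tensorHom_id _ _)
      map_comp f g := Slice.Hom.ext (tensorHom_comp_tensorHom _ _ _ _).symm }

/-- The morphism `m_{P,Q}` of presheaves over `m_{A,B}`, sending a pair of derivations to their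
tensor product. -/
def str (ht : IsMonoidalRefinement t) {A B : T} (P : t.Fiber A) (Q : t.Fiber B) :
    Psh.tensor (pos P) (pos Q) ⟶ pos (ht.tensor P Q) where
  base := strBase ht A B
  psh :=
    { app X := ↾fun x => ⟨x.1.hom ⊗ₘ x.2.hom,
        ht.isHomLift_tensor _ _ _ _ x.1.lift x.2.lift⟩
      naturality X Y f := by
        ext x
        exact Deriv.ext (tensorHom_comp_tensorHom _ _ _ _).symm }

/-- The comparison functor from the slice of the left residual `E = A \ C`, with evaluation `plug`,
to the functor category between the slices of `A` and `C`. -/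
def costrLBase (ht : IsMonoidalRefinement t) {A C E : T} (plug : A ⊗ E ⟶ C) :
    (posBase t).obj E ⟶ Cat.of ((posBase t).obj A ⥤ (posBase t).obj C) :=
  Psh.curryLBase (strBase ht A E ≫ (posBase t).map plug)

/-- The comparison morphism of presheaves for a left residual `X = P \ R`, with evaluation `ev`
over `plug`. -/
def costrL (ht : IsMonoidalRefinement t) {A C E : T} {P : t.Fiber A} {R : t.Fiber C}
    {X : t.Fiber E} (plug : A ⊗ E ⟶ C) (ev : P.1 ⊗ X.1 ⟶ R.1) (h : t.IsHomLift plug ev) :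
    pos X ⟶ Psh.residual (pos P) (pos R) :=
  Psh.curryL (str ht P X ≫ posMap (Q := ht.tensor P X) plug ev h)

/-- The comparison functor from the slice of the right residual `E = C / B`, with evaluation
`plug`, to the functor category between the slices of `B` and `C`. -/
def costrRBase (ht : IsMonoidalRefinement t) {B C E : T} (plug : E ⊗ B ⟶ C) :
    (posBase t).obj E ⟶ Cat.of ((posBase t).obj B ⥤ (posBase t).obj C) :=
  Psh.curryRBase (strBase ht E B ≫ (posBase t).map plug)

/-- The comparison morphism of presheaves for a right residual `X = R / Q`, with evaluation `ev`
over `plug`. -/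
def costrR (ht : IsMonoidalRefinement t) {B C E : T} {Q : t.Fiber B} {R : t.Fiber C}
    {X : t.Fiber E} (plug : E ⊗ B ⟶ C) (ev : X.1 ⊗ Q.1 ⟶ R.1) (h : t.IsHomLift plug ev) :
    pos X ⟶ Psh.residual (pos Q) (pos R) :=
  Psh.curryR (str ht X Q ≫ posMap (Q := ht.tensor X Q) plug ev h)

end Positive

/-- A vertical isomorphism over `A`: a pair of mutually inverse derivations over `𝟙 A`. -/
structure VerticalIso {D : Type u₁} [Category.{v₁} D] {T : Type u₂} [Category.{v₂} T]
    (t : D ⥤ T) (A : T) (X Y : D) extends X ≅ Y where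
  hom_lift : t.IsHomLift (𝟙 A) hom
  inv_lift : t.IsHomLift (𝟙 A) inv

end RefSys

/-!
The presheaf `pos P` is represented by the slice object `(P, 𝟙 A)`, with the identity derivation as
universal element. By the Yoneda lemma a morphism of presheaves which sends a universal element to a
universal element is opcartesian; this applies to `str`, which sends the pair of identities of `P`
and `Q` to the identity of `P ⊗ Q`.

For a residual, the Yoneda lemma identifies the component of `costrL` at `(Y, c)` with the map
`α ↦ P ◁ α ≫ ev` from derivations of `Y ⟹[c] X` to derivations of the composite judgment
`P ⊗ Y ⟹ R`. The residual property of `ev` makes it bijective on the underlying morphisms, and that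
of `plug` ensures that the morphism `g` found for a derivation of `P ⊗ Y ⟹ R` lies over `c`. So
`costrL` is a natural isomorphism onto a pullback of its codomain, which is what being cartesian
over the forgetful functor means.
-/

namespace RefSys

section VerticalIso

variable {D : Type u₁} [Category.{v₁} D] {T : Type u₂} [Category.{v₂} T] (p : D ⥤ T)
  {R S : T} (f : R ⟶ S)

theorem exists_verticalIso_of_isCartesian {X X' Y : D} (φ : X ⟶ Y) (φ' : X' ⟶ Y)
    [p.IsCartesian f φ] [p.IsCartesian f φ'] :
    ∃ e : VerticalIso p R X X', e.hom ≫ φ' = φ :=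
  ⟨{ toIso := Functor.IsCartesian.domainUniqueUpToIso p f φ' φ
     hom_lift := inferInstance
     inv_lift := inferInstance }, Functor.IsCartesian.fac p f φ' φ⟩

theorem exists_verticalIso_of_isCocartesian {X Y Y' : D} (φ : X ⟶ Y) (φ' : X ⟶ Y')
    [p.IsCocartesian f φ] [p.IsCocartesian f φ'] :
    ∃ e : VerticalIso p S Y Y', φ ≫ e.hom = φ' :=
  ⟨{ toIso := Functor.IsCocartesian.codomainUniqueUpToIso p f φ φ'
     hom_lift := Functor.IsCocartesian.map_isHomLift p f φ φ'
     inv_lift := Functor.IsCocartesian.map_isHomLift p f φ' φ },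
    Functor.IsCocartesian.fac p f φ φ'⟩

end VerticalIso

theorem bijective_app_of_isRepresentedBy {C : Type u₁} [Category.{v₁} C] {F H : Cᵒᵖ ⥤ Type w}
    {a : C} {x : F.obj (op a)} (hx : F.IsRepresentedBy x) :
    Function.Bijective fun η : F ⟶ H => η.app (op a) x := by
  refine ⟨fun η θ h => ?_, fun z => ?_⟩
  · ext b y
    obtain ⟨f, rfl⟩ := (hx.map_bijective (Y := b.unop)).surjective y
    exact (NatTrans.naturality_apply η f.op x).trans
      ((congrArg _ h).trans (NatTrans.naturality_apply θ f.op x).symm)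
  · let e := hx.representableBy
    refine ⟨{ app b := ↾fun y => H.map (e.homEquiv.symm y).op z
              naturality b b' u := ?_ }, ?_⟩
    · ext y
      refine (congrArg (fun k => H.map (Quiver.Hom.op k) z)
        (e.comp_homEquiv_symm y u.unop).symm).trans ?_
      exact H.map_comp_apply _ _ z
    · have : e.homEquiv.symm x = 𝟙 a := e.homEquiv.symm_apply_eq.2 (by simp [e])
      simp [this]

namespace Psh

theorem isHomLift_forget_iff {X Y : Psh.{w}} (F : X.base ⟶ Y.base) (f : X ⟶ Y) :
    forget.IsHomLift F f ↔ Hom.base f = F :=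
  ⟨fun h => (@IsHomLift.eq_of_isHomLift _ _ _ _ forget _ _ F f h).symm,
    fun h => h ▸ (inferInstance : forget.IsHomLift (forget.map f) f)⟩

theorem mk_injective {X Y : Psh.{w}} (F : X.base ⟶ Y.base) :
    Function.Injective fun α : X.psh ⟶ F.toFunctor.op ⋙ Y.psh => (⟨F, α⟩ : X ⟶ Y) :=
  fun _ _ h => eq_of_heq (Hom.mk.inj h).2

theorem isStronglyCartesian_of_bijective {X Y : Psh.{w}} (f : X ⟶ Y)
    (hf : ∀ (W : Psh.{w}) (G : W.base ⟶ X.base), Function.Bijective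
      fun η : W.psh ⟶ G.toFunctor.op ⋙ X.psh =>
        η ≫ Functor.whiskerLeft G.toFunctor.op (Hom.psh f)) :
    forget.IsStronglyCartesian (Hom.base f) f where
  toIsHomLift := (isHomLift_forget_iff _ f).2 rfl
  universal_property' {W} G k hk := by
    obtain ⟨_, κ⟩ := k
    obtain rfl := (isHomLift_forget_iff (G ≫ Hom.base f) _).1 hk
    obtain ⟨η, hη, η_unique⟩ := (hf W G).existsUnique κ
    refine ⟨(⟨G, η⟩ : Hom W X),
      ⟨(isHomLift_forget_iff _ _).2 rfl, congrArg (Hom.mk (Y := Y) _) hη⟩, ?_⟩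
    rintro ⟨_, θ⟩ ⟨hG, h⟩
    obtain rfl := (isHomLift_forget_iff G _).1 hG
    exact congrArg (Hom.mk _) (η_unique θ (mk_injective (Y := Y) _ h))

theorem isStronglyCocartesian_of_bijective {X Y : Psh.{w}} (f : X ⟶ Y)
    (hf : ∀ (Z : Psh.{w}) (G : Y.base ⟶ Z.base), Function.Bijective
      fun η : Y.psh ⟶ G.toFunctor.op ⋙ Z.psh =>
        Hom.psh f ≫ Functor.whiskerLeft (Hom.base f).toFunctor.op η) :
    forget.IsStronglyCocartesian (Hom.base f) f where
  toIsHomLift := (isHomLift_forget_iff _ f).2 rfl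
  universal_property' {Z} G k hk := by
    obtain ⟨_, κ⟩ := k
    obtain rfl := (isHomLift_forget_iff (Hom.base f ≫ G) _).1 hk
    obtain ⟨η, hη, η_unique⟩ := (hf Z G).existsUnique κ
    refine ⟨(⟨G, η⟩ : Hom Y Z),
      ⟨(isHomLift_forget_iff _ _).2 rfl, congrArg (Hom.mk (X := X) _) hη⟩, ?_⟩
    rintro ⟨_, θ⟩ ⟨hG, h⟩
    obtain rfl := (isHomLift_forget_iff G _).1 hG
    exact congrArg (Hom.mk _) (η_unique θ (mk_injective (X := X) _ h))

theorem isStronglyCartesian_of_isIso {X Y : Psh.{w}} (f : X ⟶ Y) [IsIso (Hom.psh f)] :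
    forget.IsStronglyCartesian (Hom.base f) f :=
  isStronglyCartesian_of_bijective f fun _ G =>
    (asIso (Functor.whiskerLeft G.toFunctor.op (Hom.psh f))).homToEquiv.bijective

theorem pullProj_isStronglyCartesian {A : Cat.{w, w}} (Y : Psh.{w}) (F : A ⟶ Y.base) :
    forget.IsStronglyCartesian F (pullProj Y F) :=
  have : IsIso (Hom.psh (pullProj Y F)) := inferInstanceAs (IsIso (𝟙 _))
  isStronglyCartesian_of_isIso (pullProj Y F)

theorem exists_verticalIso_pull {X Y : Psh.{w}} {F : X.base ⟶ Y.base} {f : X ⟶ Y}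
    (_ : forget.IsStronglyCartesian F f) :
    ∃ e : VerticalIso forget X.base X (pull Y F), e.hom ≫ pullProj Y F = f :=
  have := pullProj_isStronglyCartesian Y F
  exists_verticalIso_of_isCartesian forget F f (pullProj Y F)

theorem isStronglyCocartesian_of_isRepresentedBy {X Y : Psh.{w}} (f : X ⟶ Y) {a : X.base}
    {x : X.psh.obj (op a)} (hx : X.psh.IsRepresentedBy x)
    (hfx : Y.psh.IsRepresentedBy (X := (Hom.base f).toFunctor.obj a)
      ((Hom.psh f).app (op a) x)) :
    forget.IsStronglyCocartesian (Hom.base f) f :=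
  isStronglyCocartesian_of_bijective f fun _ _ =>
    ((bijective_app_of_isRepresentedBy hx).of_comp_iff' _).1
      (bijective_app_of_isRepresentedBy hfx)

theorem exists_eq_map_pushUnit {X : Psh.{w}} {B : Cat.{w, w}} {F : X.base ⟶ B} {b : B}
    (y : (push X F).psh.obj (op b)) :
    ∃ (a : X.base) (f : b ⟶ F.toFunctor.obj a) (x : X.psh.obj (op a)),
      y = (push X F).psh.map f.op ((Hom.psh (pushUnit X F)).app (op a) x) := by
  obtain ⟨⟨a, f, x⟩, rfl⟩ := Quot.exists_rep y
  exact ⟨a, f, x, congrArg (fun g => Quot.mk (PushRel X F b) ⟨a, g, x⟩) (Category.comp_id f).symm⟩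

/-- The extension along `pushUnit X F` of a transformation from the presheaf of `X`: the universal
property of the coend defining the pushforward. -/
def pushDesc {X Z : Psh.{w}} {B : Cat.{w, w}} (F : X.base ⟶ B) (G : B ⟶ Z.base)
    (κ : X.psh ⟶ (F ≫ G).toFunctor.op ⋙ Z.psh) :
    (push X F).psh ⟶ G.toFunctor.op ⋙ Z.psh where
  app b := ↾Quot.lift
    (fun x => Z.psh.map (G.toFunctor.map x.2.1).op (κ.app (op x.1) x.2.2)) (by
      rintro _ _ ⟨u, f, x⟩
      refine (congrArg _ (NatTrans.naturality_apply κ u.op x)).trans ?_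
      rw [G.toFunctor.map_comp]
      exact (Z.psh.map_comp_apply _ _ _).symm)
  naturality b b' g := by
    ext x
    induction x using Quot.ind with | mk x => ?_
    refine Eq.trans (congrArg (fun k => Z.psh.map (Quiver.Hom.op k) (κ.app (op x.1) x.2.2))
      (G.toFunctor.map_comp (X := b'.unop) (Y := b.unop) g.unop x.2.1)) ?_
    exact Z.psh.map_comp_apply (G.toFunctor.map x.2.1).op
      (Quiver.Hom.op (G.toFunctor.map (X := b'.unop) (Y := b.unop) g.unop)) _

theorem pushUnit_pushDesc {X Z : Psh.{w}} {B : Cat.{w, w}} (F : X.base ⟶ B)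
    (G : B ⟶ Z.base) (κ : X.psh ⟶ (F ≫ G).toFunctor.op ⋙ Z.psh) :
    Hom.psh (pushUnit X F) ≫ Functor.whiskerLeft F.toFunctor.op (pushDesc F G κ) = κ := by
  ext a x
  change Z.psh.map (G.toFunctor.map (𝟙 (F.toFunctor.obj a.unop))).op (κ.app a x) = κ.app a x
  rw [G.toFunctor.map_id]
  exact Z.psh.map_id_apply _ _

theorem pushUnit_isStronglyCocartesian {B : Cat.{w, w}} (X : Psh.{w}) (F : X.base ⟶ B) :
    forget.IsStronglyCocartesian F (pushUnit X F) :=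
  isStronglyCocartesian_of_bijective (pushUnit X F) fun Z G => by
    refine ⟨fun η θ h => ?_, fun κ => ⟨pushDesc F G κ, pushUnit_pushDesc F G κ⟩⟩
    ext b y
    obtain ⟨a, f, x, rfl⟩ := exists_eq_map_pushUnit y
    have hx : η.app (op (F.toFunctor.obj a)) ((Hom.psh (pushUnit X F)).app (op a) x) =
        θ.app (op (F.toFunctor.obj a)) ((Hom.psh (pushUnit X F)).app (op a) x) :=
      ConcreteCategory.congr_hom (NatTrans.congr_app h (op a)) x
    exact (NatTrans.naturality_apply η f.op _).trans
      ((congrArg _ hx).trans (NatTrans.naturality_apply θ f.op _).symm)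

theorem exists_verticalIso_push {X Y : Psh.{w}} {F : X.base ⟶ Y.base} {f : X ⟶ Y}
    (_ : forget.IsStronglyCocartesian F f) :
    ∃ e : VerticalIso forget Y.base (push X F) Y, pushUnit X F ≫ e.hom = f :=
  have := pushUnit_isStronglyCocartesian X F
  exists_verticalIso_of_isCocartesian forget F (pushUnit X F) f

theorem tensor_isRepresentedBy {X Y : Psh.{w}} {a : X.base} {b : Y.base}
    {x : X.psh.obj (op a)} {y : Y.psh.obj (op b)} (hx : X.psh.IsRepresentedBy x)
    (hy : Y.psh.IsRepresentedBy y) :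
    (tensor X Y).psh.IsRepresentedBy (X := ((a, b) : X.base × Y.base)) (x, y) where
  map_bijective := hx.map_bijective.prodMap hy.map_bijective

theorem isIso_curryL_psh {X Y Z : Psh.{w}} (f : tensor X Y ⟶ Z) {a : X.base}
    {x : X.psh.obj (op a)} (hx : X.psh.IsRepresentedBy x)
    (hf : ∀ b : Y.base, Function.Bijective fun y : Y.psh.obj (op b) =>
      (Hom.psh f).app (op (a, b)) (x, y)) :
    IsIso (Hom.psh (curryL f)) :=
  have (b : Y.baseᵒᵖ) : IsIso ((Hom.psh (curryL f)).app b) :=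
    (isIso_iff_bijective _).2
      (((bijective_app_of_isRepresentedBy hx).of_comp_iff' _).1 (hf b.unop))
  NatIso.isIso_of_isIso_app _

theorem isIso_curryR_psh {X Y Z : Psh.{w}} (f : tensor X Y ⟶ Z) {b : Y.base}
    {y : Y.psh.obj (op b)} (hy : Y.psh.IsRepresentedBy y)
    (hf : ∀ a : X.base, Function.Bijective fun x : X.psh.obj (op a) =>
      (Hom.psh f).app (op (a, b)) (x, y)) :
    IsIso (Hom.psh (curryR f)) :=
  have (a : X.baseᵒᵖ) : IsIso ((Hom.psh (curryR f)).app a) :=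
    (isIso_iff_bijective _).2
      (((bijective_app_of_isRepresentedBy hy).of_comp_iff' _).1 (hf a.unop))
  NatIso.isIso_of_isIso_app _

end Psh

section Representability

variable {D : Type u₁} [Category.{v₁} D] {T : Type u₂} [Category.{v₂} T] {t : D ⥤ T}

/-- A refinement `P ⊏ A` as the object `(P, 𝟙 A)` of the relative slice of `A`, which represents the
presheaf `pos P`. The equation `t.obj P.1 = A` turns the identity of `A` into an `eqToHom`. -/
def Slice.ofFiber {A : T} (P : t.Fiber A) : Slice t A :=
  ⟨P.1, eqToHom P.2⟩

/-- The identity derivation of `P ⟹ P`, the universal element of the presheaf `pos P`. -/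
def Deriv.id {A : T} (P : t.Fiber A) : Deriv t (Slice.ofFiber P).term P :=
  ⟨𝟙 P.1, IsHomLift.id_lift_eqToHom_domain P.2 rfl⟩

theorem Deriv.eq_map_hom {P : D} {B : T} {c : t.obj P ⟶ B} {Q : t.Fiber B} (α : Deriv t c Q) :
    c = t.map α.hom ≫ eqToHom Q.2 := by
  have := α.lift
  simpa using IsHomLift.fac t c α.hom

theorem pos_isRepresentedBy {A : T} {P : t.Fiber A} {S : Slice t A} (α : Deriv t S.term P)
    [IsIso α.hom] : (pos P).psh.IsRepresentedBy (X := (S : (pos P).base)) α where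
  map_bijective {S'} := by
    refine ⟨fun f g h => Slice.Hom.ext ((cancel_mono α.hom).1 (congrArg Deriv.hom h)),
      fun (β : Deriv t (Slice.term S') P) => ⟨(⟨β.hom ≫ inv α.hom, ?_⟩ : Slice.Hom S' S), ?_⟩⟩
    · calc
        Slice.term S' = t.map ((β.hom ≫ inv α.hom) ≫ α.hom) ≫ eqToHom P.2 := by
          simpa using β.eq_map_hom
        _ = t.map (β.hom ≫ inv α.hom) ≫ S.term := by
          rw [t.map_comp, Category.assoc, ← α.eq_map_hom]
    · exact Deriv.ext (by simp : (β.hom ≫ inv α.hom) ≫ α.hom = β.hom)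

theorem pos_isRepresentedBy_id {A : T} (P : t.Fiber A) :
    (pos P).psh.IsRepresentedBy (X := (Slice.ofFiber P : (pos P).base)) (Deriv.id P) :=
  have : IsIso (Deriv.id P).hom := inferInstanceAs (IsIso (𝟙 P.1))
  pos_isRepresentedBy (Deriv.id P)

end Representability

section Monoidal

variable {D : Type u₁} [Category.{v₁} D] {T : Type u₂} [Category.{v₂} T]
  [MonoidalCategory D] [MonoidalCategory T] {t : D ⥤ T}

theorem str_isStronglyCocartesian (ht : IsMonoidalRefinement t) {A B : T} (P : t.Fiber A)
    (Q : t.Fiber B) : Psh.forget.IsStronglyCocartesian (strBase ht A B) (str ht P Q) := by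
  refine Psh.isStronglyCocartesian_of_isRepresentedBy (str ht P Q)
    (Psh.tensor_isRepresentedBy (pos_isRepresentedBy_id P) (pos_isRepresentedBy_id Q)) ?_
  let α := (Psh.Hom.psh (str ht P Q)).app (op (Slice.ofFiber P, Slice.ofFiber Q))
    (Deriv.id P, Deriv.id Q)
  have : IsIso (Deriv.hom α) := inferInstanceAs (IsIso (𝟙 P.1 ⊗ₘ 𝟙 Q.1))
  exact pos_isRepresentedBy α

theorem IsMonoidalRefinement.map_whiskerLeft (ht : IsMonoidalRefinement t) (P : D) {X Y : D}
    (g : X ⟶ Y) :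
    t.map (P ◁ g) = eqToHom (ht.tensor_obj P X) ≫ t.obj P ◁ t.map g ≫
      eqToHom (ht.tensor_obj P Y).symm := by
  rw [← id_tensorHom, ht.tensor_map, t.map_id, id_tensorHom]

theorem IsMonoidalRefinement.map_whiskerRight (ht : IsMonoidalRefinement t) (Q : D) {X Y : D}
    (g : X ⟶ Y) :
    t.map (g ▷ Q) = eqToHom (ht.tensor_obj X Q) ≫ t.map g ▷ t.obj Q ≫
      eqToHom (ht.tensor_obj Y Q).symm := by
  rw [← tensorHom_id, ht.tensor_map, t.map_id, tensorHom_id]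

theorem IsLogicalRefinement.isLeftResidual_of_isHomLift (ht : IsLogicalRefinement t) {A C E : T}
    {P : t.Fiber A} {R : t.Fiber C} {X : t.Fiber E} {plug : A ⊗ E ⟶ C} {ev : P.1 ⊗ X.1 ⟶ R.1}
    (h : t.IsHomLift plug ev) (hev : IsLeftResidual ev) : IsLeftResidual plug := by
  obtain ⟨P, rfl⟩ := P
  obtain ⟨R, rfl⟩ := R
  obtain ⟨X, rfl⟩ := X
  obtain rfl : plug = eqToHom (ht.tensor_obj P X).symm ≫ t.map ev := by
    simpa using IsHomLift.fac t plug ev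
  exact ht.leftResidual ev hev

theorem IsLogicalRefinement.isRightResidual_of_isHomLift (ht : IsLogicalRefinement t) {B C E : T}
    {Q : t.Fiber B} {R : t.Fiber C} {X : t.Fiber E} {plug : E ⊗ B ⟶ C} {ev : X.1 ⊗ Q.1 ⟶ R.1}
    (h : t.IsHomLift plug ev) (hev : IsRightResidual ev) : IsRightResidual plug := by
  obtain ⟨Q, rfl⟩ := Q
  obtain ⟨R, rfl⟩ := R
  obtain ⟨X, rfl⟩ := X
  obtain rfl : plug = eqToHom (ht.tensor_obj X Q).symm ≫ t.map ev := by
    simpa using IsHomLift.fac t plug ev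
  exact ht.rightResidual ev hev

theorem IsMonoidalRefinement.isHomLift_of_whiskerLeft (ht : IsMonoidalRefinement t) {A C E : T}
    {P : t.Fiber A} {R : t.Fiber C} {X : t.Fiber E} {plug : A ⊗ E ⟶ C} {ev : P.1 ⊗ X.1 ⟶ R.1}
    (h : t.IsHomLift plug ev) (hplug : IsLeftResidual plug) {Y : D} {c : t.obj Y ⟶ E}
    {g : Y ⟶ X.1}
    (hg : t.IsHomLift ((eqToHom (ht.tensor_obj P.1 Y) ≫ (eqToHom P.2 ⊗ₘ c)) ≫ plug)
      (P.1 ◁ g ≫ ev)) : t.IsHomLift c g := by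
  obtain ⟨P, rfl⟩ := P
  obtain ⟨R, rfl⟩ := R
  obtain ⟨X, rfl⟩ := X
  have map_ev : t.map ev = eqToHom (ht.tensor_obj P X) ≫ plug := by
    simpa using IsHomLift.fac' t plug ev
  obtain rfl : c = t.map g := by
    refine (hplug _ _).unique ?_ rfl
    have hg' := @IsHomLift.eq_of_isHomLift _ _ _ _ t _ _ _ _ hg
    rw [← cancel_epi (eqToHom (ht.tensor_obj P Y))]
    simpa [ht.map_whiskerLeft, map_ev] using hg'
  infer_instance

theorem IsMonoidalRefinement.isHomLift_of_whiskerRight (ht : IsMonoidalRefinement t) {B C E : T}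
    {Q : t.Fiber B} {R : t.Fiber C} {X : t.Fiber E} {plug : E ⊗ B ⟶ C} {ev : X.1 ⊗ Q.1 ⟶ R.1}
    (h : t.IsHomLift plug ev) (hplug : IsRightResidual plug) {Y : D} {c : t.obj Y ⟶ E}
    {g : Y ⟶ X.1}
    (hg : t.IsHomLift ((eqToHom (ht.tensor_obj Y Q.1) ≫ (c ⊗ₘ eqToHom Q.2)) ≫ plug)
      (g ▷ Q.1 ≫ ev)) : t.IsHomLift c g := by
  obtain ⟨Q, rfl⟩ := Q
  obtain ⟨R, rfl⟩ := R
  obtain ⟨X, rfl⟩ := X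
  have map_ev : t.map ev = eqToHom (ht.tensor_obj X Q) ≫ plug := by
    simpa using IsHomLift.fac' t plug ev
  obtain rfl : c = t.map g := by
    refine (hplug _ _).unique ?_ rfl
    have hg' := @IsHomLift.eq_of_isHomLift _ _ _ _ t _ _ _ _ hg
    rw [← cancel_epi (eqToHom (ht.tensor_obj Y Q))]
    simpa [ht.map_whiskerRight, map_ev] using hg'
  infer_instance

theorem costrL_isStronglyCartesian (ht : IsMonoidalRefinement t) {A C E : T} {P : t.Fiber A}
    {R : t.Fiber C} {X : t.Fiber E} {plug : A ⊗ E ⟶ C} {ev : P.1 ⊗ X.1 ⟶ R.1}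
    (h : t.IsHomLift plug ev) (hev : IsLeftResidual ev) (hplug : IsLeftResidual plug) :
    Psh.forget.IsStronglyCartesian (costrLBase ht plug) (costrL ht plug ev h) := by
  have : IsIso (Psh.Hom.psh (costrL ht plug ev h)) := by
    refine Psh.isIso_curryL_psh _ (pos_isRepresentedBy_id P) fun S =>
      ⟨fun α β hαβ => ?_, fun γ => ?_⟩
    · have hom_eq : (𝟙 P.1 ⊗ₘ α.hom) ≫ ev = (𝟙 P.1 ⊗ₘ β.hom) ≫ ev := congrArg Deriv.hom hαβ
      simp only [id_tensorHom] at hom_eq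
      exact Deriv.ext ((hev _ _).unique hom_eq rfl)
    · obtain ⟨g, hg, -⟩ := hev _ (Deriv.hom γ)
      refine ⟨⟨g, ht.isHomLift_of_whiskerLeft h hplug ?_⟩, Deriv.ext ?_⟩
      · exact hg ▸ Deriv.lift γ
      · exact (congrArg (· ≫ ev) (id_tensorHom P.1 g)).trans hg
  exact Psh.isStronglyCartesian_of_isIso (costrL ht plug ev h)

theorem costrR_isStronglyCartesian (ht : IsMonoidalRefinement t) {B C E : T} {Q : t.Fiber B}
    {R : t.Fiber C} {X : t.Fiber E} {plug : E ⊗ B ⟶ C} {ev : X.1 ⊗ Q.1 ⟶ R.1}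
    (h : t.IsHomLift plug ev) (hev : IsRightResidual ev) (hplug : IsRightResidual plug) :
    Psh.forget.IsStronglyCartesian (costrRBase ht plug) (costrR ht plug ev h) := by
  have : IsIso (Psh.Hom.psh (costrR ht plug ev h)) := by
    refine Psh.isIso_curryR_psh _ (pos_isRepresentedBy_id Q) fun S =>
      ⟨fun α β hαβ => ?_, fun γ => ?_⟩
    · have hom_eq : (α.hom ⊗ₘ 𝟙 Q.1) ≫ ev = (β.hom ⊗ₘ 𝟙 Q.1) ≫ ev := congrArg Deriv.hom hαβ
      simp only [tensorHom_id] at hom_eq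
      exact Deriv.ext ((hev _ _).unique hom_eq rfl)
    · obtain ⟨g, hg, -⟩ := hev _ (Deriv.hom γ)
      refine ⟨⟨g, ht.isHomLift_of_whiskerRight h hplug ?_⟩, Deriv.ext ?_⟩
      · exact hg ▸ Deriv.lift γ
      · exact (congrArg (· ≫ ev) (tensorHom_id g Q.1)).trans hg
  exact Psh.isStronglyCartesian_of_isIso (costrR ht plug ev h)

end Monoidal

end RefSys

theorem mainTheorem3_general {D : Type u₁} [Category.{v₁} D] {T : Type u₂} [Category.{v₂} T]
    [MonoidalCategory D] [MonoidalCategory T] (t : D ⥤ T) (ht : RefSys.IsMonoidalRefinement t)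
    {A B C : T} (P : t.Fiber A) (Q : t.Fiber B) (R : t.Fiber C) :
    (Functor.IsStronglyCocartesian RefSys.Psh.forget
        (RefSys.strBase ht A B)
        (RefSys.str ht P Q) ∧
      ∃ e : RefSys.VerticalIso RefSys.Psh.forget ((RefSys.posBase t).obj (A ⊗ B))
          (RefSys.Psh.push (RefSys.Psh.tensor (RefSys.pos P) (RefSys.pos Q))
            (RefSys.strBase ht A B))
          (RefSys.pos (ht.tensor P Q)),
        RefSys.Psh.pushUnit _ _ ≫ e.hom = RefSys.str ht P Q) ∧
    (∀ {E : T} (X : t.Fiber E) (plug : A ⊗ E ⟶ C) (ev : P.1 ⊗ X.1 ⟶ R.1)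
        (h : t.IsHomLift plug ev), RefSys.IsLeftResidual ev → RefSys.IsLeftResidual plug →
      Functor.IsStronglyCartesian RefSys.Psh.forget
        (RefSys.costrLBase ht plug)
        (RefSys.costrL ht plug ev h) ∧
      ∃ e : RefSys.VerticalIso RefSys.Psh.forget ((RefSys.posBase t).obj E)
          (RefSys.pos X)
          (RefSys.Psh.pull (RefSys.Psh.residual (RefSys.pos P) (RefSys.pos R))
            (RefSys.costrLBase ht plug)),
        e.hom ≫ RefSys.Psh.pullProj _ _ =
          RefSys.costrL ht plug ev h) ∧
    (∀ {E : T} (X : t.Fiber E) (plug : E ⊗ B ⟶ C) (ev : X.1 ⊗ Q.1 ⟶ R.1)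
        (h : t.IsHomLift plug ev), RefSys.IsRightResidual ev → RefSys.IsRightResidual plug →
      Functor.IsStronglyCartesian RefSys.Psh.forget
        (RefSys.costrRBase ht plug)
        (RefSys.costrR ht plug ev h) ∧
      ∃ e : RefSys.VerticalIso RefSys.Psh.forget ((RefSys.posBase t).obj E)
          (RefSys.pos X)
          (RefSys.Psh.pull (RefSys.Psh.residual (RefSys.pos Q) (RefSys.pos R))
            (RefSys.costrRBase ht plug)),
        e.hom ≫ RefSys.Psh.pullProj _ _ =
          RefSys.costrR ht plug ev h) := by
  refine ⟨?_, fun X plug ev h hev hplug => ?_, fun X plug ev h hev hplug => ?_⟩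
  · have str_cocartesian := RefSys.str_isStronglyCocartesian ht P Q
    exact ⟨str_cocartesian, RefSys.Psh.exists_verticalIso_push str_cocartesian⟩
  · have costrL_cartesian := RefSys.costrL_isStronglyCartesian ht h hev hplug
    exact ⟨costrL_cartesian, RefSys.Psh.exists_verticalIso_pull costrL_cartesian⟩
  · have costrR_cartesian := RefSys.costrR_isStronglyCartesian ht h hev hplug
    exact ⟨costrR_cartesian, RefSys.Psh.exists_verticalIso_pull costrR_cartesian⟩

theorem mainTheorem3 {D : Type u₁} [Category.{v₁} D] {T : Type u₂} [Category.{v₂} T]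
    [MonoidalCategory D] [MonoidalCategory T] (t : D ⥤ T) (ht : RefSys.IsLogicalRefinement t)
    {A B C : T} (P : t.Fiber A) (Q : t.Fiber B) (R : t.Fiber C) :
    (Functor.IsStronglyCocartesian RefSys.Psh.forget
        (RefSys.strBase ht.toIsMonoidalRefinement A B)
        (RefSys.str ht.toIsMonoidalRefinement P Q) ∧
      ∃ e : RefSys.VerticalIso RefSys.Psh.forget ((RefSys.posBase t).obj (A ⊗ B))
          (RefSys.Psh.push (RefSys.Psh.tensor (RefSys.pos P) (RefSys.pos Q))
            (RefSys.strBase ht.toIsMonoidalRefinement A B))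
          (RefSys.pos (ht.toIsMonoidalRefinement.tensor P Q)),
        RefSys.Psh.pushUnit _ _ ≫ e.hom = RefSys.str ht.toIsMonoidalRefinement P Q) ∧
    (∀ {E : T} (X : t.Fiber E) (plug : A ⊗ E ⟶ C) (ev : P.1 ⊗ X.1 ⟶ R.1)
        (h : t.IsHomLift plug ev), RefSys.IsLeftResidual ev →
      Functor.IsStronglyCartesian RefSys.Psh.forget
        (RefSys.costrLBase ht.toIsMonoidalRefinement plug)
        (RefSys.costrL ht.toIsMonoidalRefinement plug ev h) ∧
      ∃ e : RefSys.VerticalIso RefSys.Psh.forget ((RefSys.posBase t).obj E)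
          (RefSys.pos X)
          (RefSys.Psh.pull (RefSys.Psh.residual (RefSys.pos P) (RefSys.pos R))
            (RefSys.costrLBase ht.toIsMonoidalRefinement plug)),
        e.hom ≫ RefSys.Psh.pullProj _ _ =
          RefSys.costrL ht.toIsMonoidalRefinement plug ev h) ∧
    (∀ {E : T} (X : t.Fiber E) (plug : E ⊗ B ⟶ C) (ev : X.1 ⊗ Q.1 ⟶ R.1)
        (h : t.IsHomLift plug ev), RefSys.IsRightResidual ev →
      Functor.IsStronglyCartesian RefSys.Psh.forget
        (RefSys.costrRBase ht.toIsMonoidalRefinement plug)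
        (RefSys.costrR ht.toIsMonoidalRefinement plug ev h) ∧
      ∃ e : RefSys.VerticalIso RefSys.Psh.forget ((RefSys.posBase t).obj E)
          (RefSys.pos X)
          (RefSys.Psh.pull (RefSys.Psh.residual (RefSys.pos Q) (RefSys.pos R))
            (RefSys.costrRBase ht.toIsMonoidalRefinement plug)),
        e.hom ≫ RefSys.Psh.pullProj _ _ =
          RefSys.costrR ht.toIsMonoidalRefinement plug ev h) := by
  obtain ⟨str_cocartesian, costrL_cartesian, costrR_cartesian⟩ :=
    mainTheorem3_general t ht.toIsMonoidalRefinement P Q R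
  exact ⟨str_cocartesian,
    fun X plug ev h hev =>
      costrL_cartesian X plug ev h hev (ht.isLeftResidual_of_isHomLift h hev),
    fun X plug ev h hev =>
      costrR_cartesian X plug ev h hev (ht.isRightResidual_of_isHomLift h hev)⟩
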